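/- A multi-valued function $\mathcal F\colon\subseteq\omega^\omega\rightrightarrows\omega^\omega$ has a set $\mathrm{dom}(\mathcal F)\subseteq\omega^\omega$ of instances and assigns to each instance $f$ a nonempty set $\mathcal F(f)\subseteq\omega^\omega$ of solutions. One says that $\mathcal F$ strongly Weihrauch reduces to $\mathcal G$, written $\mathcal F\leq_{\mathrm{sW}}\mathcal G$, if there are Turing functionals $\Phi,\Psi\colon\subseteq\omega^\omega\to\omega^\omega$ such that $\Phi(f)\in\mathrm{dom}(\mathcal G)$ for all $f\in\mathrm{dom}(\mathcal F)$, and $\Psi(g)\in\mathcal F(f)$ for all $f\in\mathrm{dom}(\mathcal F)$ and all $g\in\mathcal G(\Phi(f))$. Subsets of $\omega$ are coded by their characteristic functions, a sequence $(A_i)_{i\in\omega}$ of subsets of $\omega$ by the characteristic function of $\{\langle i,x\rangle : x\in A_i\}$, and a simple graph $G=(V,E)$ with $V\subseteq\omega$ by the pair of the characteristic functions of $V$ and of $\{\langle x,y\rangle : x<y,\ \{x,y\}\in E\}$. $\mathsf{COH}$ is the multi-valued function whose instances are the sequences $(A_i)_{i\in\omega}$ of subsets of $\omega$, and whose solutions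 to such an instance are the infinite sets $C\subseteq\omega$ such that for each $i$ either $C\setminus A_i$ or $C\cap A_i$ is finite. $\mathsf{wRSg}$ (the weak Rival--Sands theorem for graphs) is the multi-valued function whose instances are the infinite simple graphs $G=(V,E)$ with $V\subseteq\omega$, and whose solutions to $G$ are the infinite sets $H\subseteq V$ such that for every $v\in H$ either $H\cap N(v)$ is infinite or $|H\cap N(v)|\leq 1$, where $N(v)=\{u\in V:\{u,v\}\in E\}$. **Theorem.** $\mathsf{COH}\leq_{\mathrm{sW}}\mathsf{wRSg}$. -/

import Mathlib

/-- Programs for oracle computation: the usual generators of the partial recursive functions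
together with a query to the oracle. -/
inductive OracleCode : Type
  | zero : OracleCode
  | succ : OracleCode
  | left : OracleCode
  | right : OracleCode
  | oracle : OracleCode
  | pair : OracleCode → OracleCode → OracleCode
  | comp : OracleCode → OracleCode → OracleCode
  | prec : OracleCode → OracleCode → OracleCode
  | rfind : OracleCode → OracleCode

namespace OracleCode

/-- The partial function `ℕ →. ℕ` that a program computes when its oracle is `f`. The clauses are
those of Mathlib's `Nat.RecursiveIn {f}`; the program does not depend on `f`. -/
def eval (f : ℕ → ℕ) : OracleCode → ℕ →. ℕ
  | zero => fun _ => Part.some 0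
  | succ => fun n => Part.some (n + 1)
  | left => fun n => Part.some n.unpair.1
  | right => fun n => Part.some n.unpair.2
  | oracle => fun n => Part.some (f n)
  | pair c d => fun n => Nat.pair <$> eval f c n <*> eval f d n
  | comp c d => fun n => eval f d n >>= eval f c
  | prec c d => fun p =>
      let (a, n) := Nat.unpair p
      n.rec (eval f c a) fun y IH => do
        let i ← IH
        eval f d (Nat.pair a (Nat.pair y i))
  | rfind c => fun a => Nat.rfind fun n => (fun m => m = 0) <$> eval f c (Nat.pair a n)

/-- The partial function on Baire space given by a program: it is defined at `f` when the program
with oracle `f` halts on every input, and its value is then the total function computed. -/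
def functional (c : OracleCode) : (ℕ → ℕ) →. (ℕ → ℕ) := fun f =>
  ⟨∀ n, (c.eval f n).Dom, fun h n => (c.eval f n).get (h n)⟩

end OracleCode

/-- A partial function on Baire space is a Turing functional if one oracle program computes it. -/
def IsTuringFunctional (Φ : (ℕ → ℕ) →. (ℕ → ℕ)) : Prop :=
  ∃ c : OracleCode, Φ = c.functional

/-- A multi-valued (partial) function from Baire space to Baire space: a set of instances, and for
each instance a nonempty set of solutions. (The value of `sol` outside `dom` is irrelevant.) -/
structure MultiFunction where
  dom : Set (ℕ → ℕ)
  sol : (ℕ → ℕ) → Set (ℕ → ℕ)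
  sol_nonempty : ∀ f ∈ dom, (sol f).Nonempty

/-- Strong Weihrauch reducibility: there are Turing functionals `Φ` and `Ψ` such that for every
instance `f` of `F`, `Φ f` is defined and is an instance of `G`, and for every `G`-solution `g` to
`Φ f`, `Ψ g` is defined and is an `F`-solution to `f`. -/
def StronglyWeihrauchReducible (F G : MultiFunction) : Prop :=
  ∃ Φ Ψ : (ℕ → ℕ) →. (ℕ → ℕ), IsTuringFunctional Φ ∧ IsTuringFunctional Ψ ∧
    ∀ f ∈ F.dom, ∃ p ∈ Φ f, p ∈ G.dom ∧ ∀ g ∈ G.sol p, ∃ q ∈ Ψ g, q ∈ F.sol f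

/-- The code of a set of natural numbers: its characteristic function. -/
noncomputable def codeSet (X : Set ℕ) : ℕ → ℕ := X.indicator fun _ => 1

/-- The code of a sequence of sets: the characteristic function of `{⟨i, x⟩ : x ∈ A i}`. -/
noncomputable def codeSeq (A : ℕ → Set ℕ) : ℕ → ℕ :=
  codeSet {n | n.unpair.2 ∈ A n.unpair.1}

/-- The pairing of two elements of Baire space: `f` on even places, `g` on odd places. -/
def joinFun (f g : ℕ → ℕ) : ℕ → ℕ := fun n => if n % 2 = 0 then f (n / 2) else g (n / 2)

/-- Simple graphs whose vertex set is a subset of `ℕ`. -/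
abbrev NatGraph : Type := (⊤ : SimpleGraph ℕ).Subgraph

/-- The code of a graph `(V, E)`: the pairing of the characteristic functions of `V` and of
`{⟨x, y⟩ : x < y, x and y adjacent}`. -/
noncomputable def codeGraph (G : NatGraph) : ℕ → ℕ :=
  joinFun (codeSet G.verts) (codeSet {n | n.unpair.1 < n.unpair.2 ∧ G.Adj n.unpair.1 n.unpair.2})

/-- `C` is cohesive for the sequence `A`: it is infinite and, for each `i`, almost contained in
`A i` or almost contained in the complement of `A i`. -/
def IsCohesive (A : ℕ → Set ℕ) (C : Set ℕ) : Prop :=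
  C.Infinite ∧ ∀ i, (C \ A i).Finite ∨ (C \ (A i)ᶜ).Finite

/-- `H` is an infinite set of vertices such that each member of `H` is adjacent to infinitely many
or to at most one of the members of `H`. -/
def IsWeakRivalSands (G : NatGraph) (H : Set ℕ) : Prop :=
  H ⊆ G.verts ∧ H.Infinite ∧
    ∀ v ∈ H, (H ∩ G.neighborSet v).Infinite ∨ (H ∩ G.neighborSet v).encard ≤ 1

/-- Every sequence of sets has a cohesive set. -/
theorem exists_isCohesive (A : ℕ → Set ℕ) : ∃ C, IsCohesive A C := by
  classical
  let U := Filter.hyperfilter ℕ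
  let B : ℕ → Set ℕ := fun i => if A i ∈ U then A i else (A i)ᶜ
  have hB : ∀ i, B i ∈ U := by
    intro i
    by_cases h : A i ∈ U
    · simp [B, h]
    · simpa [B, h] using Ultrafilter.compl_mem_iff_notMem.2 h
  have hgt : ∀ x : ℕ, Set.Ioi x ∈ U := fun x =>
    Filter.hyperfilter_le_cofinite (Filter.mem_cofinite.2 (by
      rw [Set.compl_Ioi]; exact Set.finite_Iic x))
  obtain ⟨f, -, hf⟩ := exists_seq_of_forall_finset_exists (fun _ : ℕ => True)
    (fun x y => x < y ∧ ∀ i ≤ x, y ∈ B i) (by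
      intro s _
      have h1 : (⋂ x ∈ s, (Set.Ioi x ∩ ⋂ i ∈ Finset.range (x + 1), B i)) ∈ (U : Filter ℕ) := by
        rw [Filter.biInter_finset_mem]
        intro x _
        refine Filter.inter_mem (hgt x) ?_
        rw [Filter.biInter_finset_mem]
        exact fun i _ => hB i
      obtain ⟨y, hy⟩ := U.nonempty_of_mem h1
      refine ⟨y, trivial, fun x hx => ?_⟩
      simp only [Set.mem_iInter, Set.mem_inter_iff, Set.mem_Ioi, Finset.mem_range] at hy
      exact ⟨(hy x hx).1, fun i hi => (hy x hx).2 i (by omega)⟩)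
  have hmono : StrictMono f := fun m n h => (hf m n h).1
  refine ⟨Set.range f, Set.infinite_range_of_injective hmono.injective, fun i => ?_⟩
  have hfin : (Set.range f \ B i).Finite := by
    refine ((Set.finite_Iic i).image f).subset ?_
    rintro _ ⟨⟨n, rfl⟩, hn⟩
    refine ⟨n, ?_, rfl⟩
    by_contra h
    exact hn ((hf i n (by simpa using h)).2 i hmono.le_apply)
  by_cases h : A i ∈ U
  · left; simpa [B, h] using hfin
  · right; simpa [B, h] using hfin

/-- Every infinite graph has a weak Rival-Sands set (an infinite clique or independent set). -/
theorem exists_isWeakRivalSands (G : NatGraph) (hG : G.verts.Infinite) :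
    ∃ H, IsWeakRivalSands G H := by
  classical
  have : (Filter.cofinite ⊓ Filter.principal G.verts).NeBot :=
    Filter.cofinite_inf_principal_neBot_iff.2 hG
  let U := Ultrafilter.of (Filter.cofinite ⊓ Filter.principal G.verts)
  have hU : (U : Filter ℕ) ≤ Filter.cofinite ⊓ Filter.principal G.verts := Ultrafilter.of_le _
  have hV : G.verts ∈ U := hU (Filter.mem_inf_of_right (Filter.mem_principal_self _))
  have hgt : ∀ x : ℕ, Set.Ioi x ∈ U := fun x =>
    hU (Filter.mem_inf_of_left (Filter.mem_cofinite.2 (by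
      rw [Set.compl_Ioi]; exact Set.finite_Iic x)))
  have key : ∀ (D : Set ℕ) (N : ℕ → Set ℕ), D ∈ U → (∀ x ∈ D, N x ∈ U) →
      ∃ f : ℕ → ℕ, StrictMono f ∧ (∀ n, f n ∈ D) ∧ ∀ m n, m < n → f n ∈ N (f m) := by
    intro D N hD hN
    obtain ⟨f, hfD, hf⟩ := exists_seq_of_forall_finset_exists (fun x => x ∈ D)
      (fun x y => x < y ∧ y ∈ N x) (by
        intro s hs
        have h1 : (D ∩ ⋂ x ∈ s, (Set.Ioi x ∩ N x)) ∈ (U : Filter ℕ) := by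
          refine Filter.inter_mem hD ?_
          rw [Filter.biInter_finset_mem]
          exact fun x hx => Filter.inter_mem (hgt x) (hN x (hs x hx))
        obtain ⟨y, hy⟩ := U.nonempty_of_mem h1
        simp only [Set.mem_iInter, Set.mem_inter_iff, Set.mem_Ioi] at hy
        exact ⟨y, hy.1, hy.2⟩)
    exact ⟨f, fun m n h => (hf m n h).1, hfD, fun m n h => (hf m n h).2⟩
  by_cases hD : {x | G.neighborSet x ∈ U} ∈ U
  · obtain ⟨f, hf, hfD, hfN⟩ := key (G.verts ∩ {x | G.neighborSet x ∈ U}) G.neighborSet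
      (Filter.inter_mem hV hD) (fun x hx => hx.2)
    refine ⟨Set.range f, ?_, Set.infinite_range_of_injective hf.injective, ?_⟩
    · rintro _ ⟨n, rfl⟩; exact (hfD n).1
    · rintro _ ⟨n, rfl⟩
      left
      refine ((Set.Ioi_infinite n).image hf.injective.injOn).mono ?_
      rintro _ ⟨m, hm, rfl⟩
      exact ⟨⟨m, rfl⟩, hfN n m hm⟩
  · obtain ⟨f, hf, hfD, hfN⟩ := key (G.verts ∩ {x | G.neighborSet x ∈ U}ᶜ)
      (fun x => (G.neighborSet x)ᶜ)
      (Filter.inter_mem hV (Ultrafilter.compl_mem_iff_notMem.2 hD))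
      (fun x hx => Ultrafilter.compl_mem_iff_notMem.2 hx.2)
    refine ⟨Set.range f, ?_, Set.infinite_range_of_injective hf.injective, ?_⟩
    · rintro _ ⟨n, rfl⟩; exact (hfD n).1
    · rintro _ ⟨n, rfl⟩
      right
      have : Set.range f ∩ G.neighborSet (f n) = ∅ := by
        rw [Set.eq_empty_iff_forall_notMem]
        rintro _ ⟨⟨m, rfl⟩, hm⟩
        rcases lt_trichotomy n m with h | h | h
        · exact hfN n m h hm
        · subst h; exact G.loopless.irrefl _ hm
        · exact hfN m n h (G.adj_symm hm)
      simp [this]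

/-- The cohesiveness principle. Instances: sequences of subsets of `ℕ`. Solutions: cohesive sets. -/
noncomputable def COH : MultiFunction where
  dom := {f | ∃ A : ℕ → Set ℕ, f = codeSeq A}
  sol f := {g | ∃ (A : ℕ → Set ℕ) (C : Set ℕ), f = codeSeq A ∧ g = codeSet C ∧ IsCohesive A C}
  sol_nonempty := by
    rintro _ ⟨A, rfl⟩
    obtain ⟨C, hC⟩ := exists_isCohesive A
    exact ⟨codeSet C, A, C, rfl, rfl, hC⟩

/-- The weak Rival-Sands theorem for graphs. Instances: infinite graphs `(V, E)` with `V ⊆ ℕ`.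
Solutions: infinite sets `H ⊆ V` such that each vertex in `H` has infinitely many neighbours in
`H` or at most one. -/
noncomputable def wRSg : MultiFunction where
  dom := {f | ∃ G : NatGraph, G.verts.Infinite ∧ f = codeGraph G}
  sol f := {g | ∃ (G : NatGraph) (H : Set ℕ), f = codeGraph G ∧ g = codeSet H ∧
    IsWeakRivalSands G H}
  sol_nonempty := by
    rintro _ ⟨G, hG, rfl⟩
    obtain ⟨H, hH⟩ := exists_isWeakRivalSands G hG
    exact ⟨codeSet H, G, H, rfl, rfl, hH⟩

/-! Represent `x` by the string of the bits `A_0(x), …, A_{x-1}(x)`, read in binary after a leading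
1. Its length recovers `x`, so being a vertex is decidable from `A`; a set of numbers `x` is
cohesive once it is infinite and each finite prefix of these strings is eventually constant along
it. Join two vertices when the larger number has the smaller binary fraction. If a point `c` of a
solution `H` has smaller value than two earlier points of `H`, it has two neighbours in `H`, hence
infinitely many, so some later point of `H` has smaller value still (`exists_lt_binaryValue_lt`).

Now pass to the descent records of `H`, which are computable from `H` alone, without knowing which
of two cases holds. If `H` contains a descent of length three, descents continue forever, so there
are infinitely many records (`infinite_descentRecords`), and from some point on they decrease
strictly; their prefixes are then nonincreasing and stabilise. If there is no such descent, every
point of `H` is a record, and two prefixes cannot both occur infinitely often: the smaller one,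
after two occurrences of the larger, would start a descent of length three. Both cases are in
`exists_finite_ne_of_descentRecords`.

Both functionals are primitive recursive in an oracle segment of length bounded in advance
(`exists_eval_eq_of_primrec`). -/

namespace OracleCode

/-! ### Oracle programs for primitive recursive operations -/

theorem eval_comp_of_eq {c d : OracleCode} {f : ℕ → ℕ} {n m : ℕ} (h : d.eval f n = Part.some m) :
    (comp c d).eval f n = c.eval f m := by
  change (d.eval f n).bind (c.eval f) = _
  rw [h]
  exact Part.bind_some m (c.eval f)

theorem eval_pair_of_eq {c d : OracleCode} {f : ℕ → ℕ} {n k m : ℕ} (hc : c.eval f n = Part.some k)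
    (hd : d.eval f n = Part.some m) : (pair c d).eval f n = Part.some (Nat.pair k m) := by
  simp [eval, hc, hd, Seq.seq]

/-- Every primitive recursive function has a program that ignores its oracle. -/
theorem exists_eval_eq_of_natPrimrec {F : ℕ → ℕ} (hF : Nat.Primrec F) :
    ∃ c : OracleCode, ∀ f n, c.eval f n = Part.some (F n) := by
  induction hF with
  | zero => exact ⟨zero, fun _ _ => rfl⟩
  | succ => exact ⟨succ, fun _ _ => rfl⟩
  | left => exact ⟨left, fun _ _ => rfl⟩
  | right => exact ⟨right, fun _ _ => rfl⟩
  | pair _ _ ihF ihG =>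
    obtain ⟨c, hc⟩ := ihF
    obtain ⟨d, hd⟩ := ihG
    exact ⟨pair c d, fun f n => eval_pair_of_eq (hc f n) (hd f n)⟩
  | comp _ _ ihF ihG =>
    obtain ⟨c, hc⟩ := ihF
    obtain ⟨d, hd⟩ := ihG
    exact ⟨comp c d, fun f n => (eval_comp_of_eq (hd f n)).trans (hc f _)⟩
  | prec _ _ ihF ihG =>
    obtain ⟨c, hc⟩ := ihF
    obtain ⟨d, hd⟩ := ihG
    refine ⟨prec c d, fun f n => ?_⟩
    simp only [eval, Nat.unpaired]
    induction n.unpair.2 with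
    | zero => simp [hc]
    | succ k ih =>
      simp only at ih ⊢
      rw [ih]
      simp [hd]

/-- The list of the first `n` values of the oracle can be computed from `n`. -/
theorem exists_eval_eq_encode_map_range :
    ∃ c : OracleCode, ∀ f n, c.eval f n = Part.some (Encodable.encode ((List.range n).map f)) := by
  have hF : Primrec fun p : ℕ => Encodable.encode
      (((Encodable.decode (α := List ℕ) p.unpair.2.unpair.2).getD []) ++ [p.unpair.2.unpair.1]) :=
    Primrec.encode.comp (Primrec.list_concat.comp
      (Primrec.option_getD.comp
        (Primrec.decode.comp (Primrec.snd.comp (Primrec.unpair.comp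
          (Primrec.snd.comp Primrec.unpair)))) (Primrec.const _))
      (Primrec.fst.comp (Primrec.unpair.comp (Primrec.snd.comp Primrec.unpair))))
  obtain ⟨s, hs⟩ := exists_eval_eq_of_natPrimrec (Primrec.nat_iff.1 hF)
  obtain ⟨z, hz⟩ := exists_eval_eq_of_natPrimrec
    (Nat.Primrec.const (Encodable.encode ([] : List ℕ)))
  obtain ⟨j, hj⟩ := exists_eval_eq_of_natPrimrec (Nat.Primrec.pair Nat.Primrec.zero Nat.Primrec.id)
  -- The recursion step on `⟨0, ⟨k, l⟩⟩`: query the oracle at `k` and append the answer to `l`. The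
  -- first component is a dummy parameter.
  let e := comp s (pair left (pair (comp oracle (comp left right)) (comp right right)))
  have he : ∀ f k (l : List ℕ), e.eval f (Nat.pair 0 (Nat.pair k (Encodable.encode l))) =
      Part.some (Encodable.encode (l ++ [f k])) := fun f k l => by
    have h1 : left.eval f (Nat.pair 0 (Nat.pair k (Encodable.encode l))) = Part.some 0 := by
      simp [eval]
    have h2 : right.eval f (Nat.pair 0 (Nat.pair k (Encodable.encode l))) =
        Part.some (Nat.pair k (Encodable.encode l)) := by
      simp [eval]
    have h3 : left.eval f (Nat.pair k (Encodable.encode l)) = Part.some k := by simp [eval]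
    have h4 : right.eval f (Nat.pair k (Encodable.encode l)) =
        Part.some (Encodable.encode l) := by
      simp [eval]
    rw [eval_comp_of_eq (eval_pair_of_eq h1 (eval_pair_of_eq
      ((eval_comp_of_eq ((eval_comp_of_eq h2).trans h3)).trans rfl)
      ((eval_comp_of_eq h2).trans h4))), hs]
    simp
  refine ⟨comp (prec z e) j, fun f n => (eval_comp_of_eq (hj f n)).trans ?_⟩
  simp only [eval, Nat.unpair_pair, id]
  induction n with
  | zero => simp [hz]
  | succ k ih =>
    simp only at ih ⊢
    rw [ih]
    simp [he, List.range_succ]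

/-- A function that is primitive recursive in an initial segment of the oracle of primitive
recursive length is computed by a program. -/
theorem exists_eval_eq_of_primrec {F : ℕ × List ℕ → ℕ} (hF : Primrec F) {u : ℕ → ℕ}
    (hu : Primrec u) :
    ∃ c : OracleCode, ∀ f n, c.eval f n = Part.some (F (n, (List.range (u n)).map f)) := by
  have hG : Primrec fun p : ℕ => F (p.unpair.1,
      (Encodable.decode (α := List ℕ) p.unpair.2).getD []) :=
    hF.comp (Primrec.pair (Primrec.fst.comp Primrec.unpair)
      (Primrec.option_getD.comp (Primrec.decode.comp (Primrec.snd.comp Primrec.unpair))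
        (Primrec.const _)))
  obtain ⟨c, hc⟩ := exists_eval_eq_of_natPrimrec (Primrec.nat_iff.1 hG)
  obtain ⟨d, hd⟩ := exists_eval_eq_of_natPrimrec (Primrec.nat_iff.1 hu)
  obtain ⟨l, hl⟩ := exists_eval_eq_encode_map_range
  obtain ⟨i, hi⟩ := exists_eval_eq_of_natPrimrec Nat.Primrec.id
  refine ⟨comp c (pair i (comp l d)), fun f n => ?_⟩
  rw [eval_comp_of_eq (eval_pair_of_eq (hi f n) ((eval_comp_of_eq (hd f n)).trans (hl f _))), hc]
  simp

/-- The functional computed by a program that halts on all inputs. -/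
theorem mem_functional_of_eval_eq {c : OracleCode} {f g : ℕ → ℕ}
    (h : ∀ n, c.eval f n = Part.some (g n)) : g ∈ c.functional f := by
  refine ⟨fun n => by simp [h], ?_⟩
  funext n
  simp [functional, h]

end OracleCode

/-! ### Primitive recursive powers and logarithms -/

namespace Primrec

theorem nat_pow : Primrec₂ fun a b : ℕ => a ^ b :=
  Primrec₂.unpaired'.1 Nat.Primrec.pow

theorem nat_log_two : Primrec (Nat.log 2) := by
  have h : Primrec fun n : ℕ => Nat.findGreatest (fun k => 2 ^ k ≤ n) n :=
    Primrec.nat_findGreatest Primrec.id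
      (Primrec.nat_le.comp (nat_pow.comp (Primrec.const 2) Primrec.snd) Primrec.fst)
  refine h.of_eq fun n => ?_
  rcases Nat.eq_zero_or_pos n with rfl | hn
  · simp
  · rw [Nat.findGreatest_eq_iff]
    refine ⟨Nat.log_le_self 2 n, fun _ => Nat.pow_log_le_self 2 hn.ne', fun k hk _ h => ?_⟩
    exact absurd (Nat.le_log_of_pow_le (by norm_num) h) (by omega)

end Primrec

/-! ### Combinatorics of descents -/

/-- The points of `H` at which `r` is smaller than at the end of every previous descent of
length three in `H`. -/
def descentRecords (r : ℕ → ℚ) (H : Set ℕ) : Set ℕ :=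
  {h | h ∈ H ∧ ∀ c < h, ∀ b < c, ∀ a < b, a ∈ H → b ∈ H → c ∈ H →
    r b < r a → r c < r b → r h < r c}

/-- There are infinitely many such points if every descent of length three can be continued. -/
theorem infinite_descentRecords {r : ℕ → ℚ} {H : Set ℕ} (hH : H.Infinite)
    (hE : ∀ a ∈ H, ∀ b ∈ H, ∀ c ∈ H, a < b → b < c → r b < r a → r c < r b →
      ∃ d ∈ H, c < d ∧ r d < r c) :
    (descentRecords r H).Infinite := by
  classical
  let E : Set ℕ := {c | c ∈ H ∧ ∃ a ∈ H, ∃ b ∈ H, a < b ∧ b < c ∧ r b < r a ∧ r c < r b}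
  by_cases hne : E.Nonempty
  · obtain ⟨c₀, hc₀⟩ := hne
    rw [Set.infinite_iff_exists_gt]
    intro N
    -- `E` consists of the ends of descents. The first member of `E` with value below the minimum
    -- over `E` up to `max N c₀` is a record, and lies beyond `N`.
    obtain ⟨e, heS, hmin⟩ := ((Finset.range (max N c₀ + 1)).filter (· ∈ E)).exists_min_image r
      ⟨c₀, by simpa using hc₀⟩
    simp only [Finset.mem_filter, Finset.mem_range] at heS hmin
    have hstep : ∀ c ∈ E, ∃ d ∈ E, c < d ∧ r d < r c := by
      rintro c ⟨hc, a, ha, b, hb, hab, hbc, h1, h2⟩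
      obtain ⟨d, hd, hcd, h3⟩ := hE a ha b hb c hc hab hbc h1 h2
      exact ⟨d, ⟨hd, b, hb, c, hc, hbc, hcd, h2, h3⟩, hcd, h3⟩
    have hex : ∃ d, d ∈ E ∧ r d < r e := by
      obtain ⟨d, hd, -, h⟩ := hstep e heS.2
      exact ⟨d, hd, h⟩
    obtain ⟨hd, hde⟩ := Nat.find_spec hex
    refine ⟨Nat.find hex, ⟨hd.1, fun c hc b hb a ha haH hbH hcH h1 h2 => ?_⟩, ?_⟩
    · have hcE : c ∈ E := ⟨hcH, a, haH, b, hbH, ha, hb, h1, h2⟩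
      have := Nat.find_min hex hc
      simp only [not_and, not_lt] at this
      exact hde.trans_le (this hcE)
    · by_contra hcon
      exact absurd (hmin _ ⟨by omega, hd⟩) (not_le.2 hde)
  · refine hH.mono fun h hh => ⟨hh, fun c hc b hb a ha haH hbH hcH h1 h2 => ?_⟩
    exact (hne ⟨c, hcH, a, haH, b, hbH, ha, hb, h1, h2⟩).elim

/-- If every point below two previous ones has a later point below it, then any function of finite
range that is eventually monotone in `r` is eventually constant on these points. -/
theorem exists_finite_ne_of_descentRecords {r : ℕ → ℚ} {H : Set ℕ}
    (hE : ∀ a ∈ H, ∀ b ∈ H, ∀ c ∈ H, a < c → b < c → a ≠ b → r c < r a → r c < r b →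
      ∃ d ∈ H, c < d ∧ r d < r c)
    {q : ℕ → ℕ} {n M : ℕ} (hqM : ∀ a ∈ H, q a < M)
    (hq : ∀ a ∈ H, ∀ b ∈ H, n ≤ a → n ≤ b → q a < q b → r a < r b) :
    ∃ u, {h ∈ descentRecords r H | q h ≠ u}.Finite := by
  classical
  by_cases hne : ∃ c ∈ H, ∃ a ∈ H, ∃ b ∈ H, a < b ∧ b < c ∧ r b < r a ∧ r c < r b
  · obtain ⟨c, hc, a, ha, b, hb, hab, hbc, h1, h2⟩ := hne
    let T : Set ℕ := {h ∈ descentRecords r H | c < h ∧ n ≤ h}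
    -- A record `h` after `c` ends the descent `b, c, h`, so any later record has smaller value than
    -- `h`.
    have hanti : ∀ h ∈ T, ∀ k ∈ T, h < k → q k ≤ q h := by
      rintro h ⟨hh, hch, hnh⟩ k ⟨hk, hck, hnk⟩ hhk
      by_contra hlt
      have h3 := hh.2 c hch b hbc a hab ha hb hc h1 h2
      have h4 := hk.2 h hhk c hch b hbc hb hc hh.1 h2 h3
      exact absurd (hq h hh.1 k hk.1 hnh hnk (not_le.1 hlt)) (not_lt.2 h4.le)
    by_cases hT : T.Nonempty
    · obtain ⟨h₀, hh₀, hmin⟩ := exists_minimalFor_of_wellFoundedLT (· ∈ T) q hT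
      refine ⟨q h₀, (Set.finite_Iic (max (max c n) h₀)).subset ?_⟩
      rintro h ⟨hh, hne⟩
      by_contra hlt
      simp only [Set.mem_Iic, not_le, max_lt_iff] at hlt
      have hhT : h ∈ T := ⟨hh, hlt.1.1, hlt.1.2.le⟩
      have hle := hanti h₀ hh₀ h hhT hlt.2
      exact hne (le_antisymm hle (hmin hhT hle))
    · refine ⟨0, (Set.finite_Iic (max c n)).subset ?_⟩
      rintro h ⟨hh, -⟩
      by_contra hlt
      simp only [Set.mem_Iic, not_le, max_lt_iff] at hlt
      exact hT ⟨h, hh, hlt.1, hlt.2.le⟩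
  -- With no descent continued from two points, `c` of value `u` after `a < b` of value `v` would
  -- give, by `hE`, the descent `a, c, d`.
  · have key : ∀ u v, u < v → {h ∈ H | q h = u}.Infinite → {h ∈ H | q h = v}.Finite := by
      intro u v huv hu
      by_contra hv
      rw [← Set.Infinite] at hv
      obtain ⟨a, ⟨ha, hau⟩, hna⟩ := hv.exists_gt n
      obtain ⟨b, ⟨hb, hbu⟩, hab⟩ := hv.exists_gt a
      obtain ⟨c, ⟨hc, hcu⟩, hbc⟩ := hu.exists_gt b
      have hca := hq c hc a ha (by omega) (by omega) (by omega)
      have hcb := hq c hc b hb (by omega) (by omega) (by omega)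
      obtain ⟨d, hd, hcd, hdc⟩ := hE a ha b hb c hc (by omega) hbc (by omega) hca hcb
      exact hne ⟨d, hd, a, ha, c, hc, by omega, hcd, hca, hdc⟩
    have hcover : ∀ u, {h ∈ descentRecords r H | q h ≠ u} ⊆
        ⋃ v ∈ {v | v < M ∧ v ≠ u}, {h ∈ H | q h = v} := by
      rintro u h ⟨hh, hu⟩
      simp only [Set.mem_iUnion]
      exact ⟨q h, ⟨hqM h hh.1, hu⟩, hh.1, rfl⟩
    have hfin : ∀ u, {v | v < M ∧ v ≠ u}.Finite := fun u =>
      (Set.finite_Iio M).subset fun v hv => hv.1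
    by_cases hu : ∃ u, {h ∈ H | q h = u}.Infinite
    · obtain ⟨u, hu⟩ := hu
      refine ⟨u, ((hfin u).biUnion fun v hv => ?_).subset (hcover u)⟩
      rcases lt_or_gt_of_ne hv.2 with h | h
      · by_contra hvi
        exact hu (key v u h hvi)
      · exact key u v h hu
    · refine ⟨0, ((hfin 0).biUnion fun v _ => ?_).subset (hcover 0)⟩
      exact Set.not_infinite.1 fun h => hu ⟨v, h⟩

/-! ### Binary strings as vertices -/

/-- The string of the first `k` values `f ⟨0, x⟩, f ⟨1, x⟩, …`, read in binary after a leading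
digit one. -/
def prefixCode (f : ℕ → ℕ) (x k : ℕ) : ℕ :=
  Nat.rec 1 (fun i s => 2 * s + f (Nat.pair i x)) k

/-- The vertex that represents the number `x` in the graph of the sequence coded by `f`. -/
def vertexCode (f : ℕ → ℕ) (x : ℕ) : ℕ := prefixCode f x x

theorem prefixCode_congr {f g : ℕ → ℕ} {x k : ℕ}
    (h : ∀ i < k, f (Nat.pair i x) = g (Nat.pair i x)) : prefixCode f x k = prefixCode g x k := by
  induction k with
  | zero => rfl
  | succ k ih =>
    change 2 * prefixCode f x k + _ = 2 * prefixCode g x k + _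
    rw [ih fun i hi => h i (by omega), h k (by omega)]

section Bits

variable {f : ℕ → ℕ}

theorem log_prefixCode (hf : ∀ n, f n ≤ 1) (x k : ℕ) : Nat.log 2 (prefixCode f x k) = k := by
  suffices h : 2 ^ k ≤ prefixCode f x k ∧ prefixCode f x k < 2 ^ (k + 1) from
    Nat.log_eq_of_pow_le_of_lt_pow h.1 h.2
  induction k with
  | zero => exact ⟨le_rfl, by norm_num [prefixCode]⟩
  | succ k ih =>
    have h : prefixCode f x (k + 1) = 2 * prefixCode f x k + f (Nat.pair k x) := rfl
    have := hf (Nat.pair k x)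
    rw [h, pow_succ 2 (k + 1)]
    rw [pow_succ] at ih ⊢
    omega

theorem log_vertexCode (hf : ∀ n, f n ≤ 1) (x : ℕ) : Nat.log 2 (vertexCode f x) = x :=
  log_prefixCode hf x x

theorem prefixCode_div (hf : ∀ n, f n ≤ 1) (x k d : ℕ) :
    prefixCode f x (k + d) / 2 ^ d = prefixCode f x k := by
  induction d with
  | zero => simp
  | succ d ih =>
    have h : prefixCode f x (k + (d + 1)) =
      2 * prefixCode f x (k + d) + f (Nat.pair (k + d) x) := rfl
    have := hf (Nat.pair (k + d) x)
    rw [h, pow_succ', ← Nat.div_div_eq_div_mul, ← ih]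
    congr 1
    omega

end Bits

/-- A number as a binary fraction with one digit before the point. -/
def binaryValue (v : ℕ) : ℚ := v / 2 ^ Nat.log 2 v

/-- Clearing denominators leaves a comparison of natural numbers, which is visibly primitive
recursive. -/
theorem binaryValue_lt_iff {v w : ℕ} :
    binaryValue w < binaryValue v ↔ w * 2 ^ Nat.log 2 v < v * 2 ^ Nat.log 2 w := by
  rw [binaryValue, binaryValue, div_lt_div_iff₀ (by positivity) (by positivity)]
  exact_mod_cast Iff.rfl

/-- The first `n` digits after the point of `binaryValue v`, with the leading one. -/
def binaryPrefix (n v : ℕ) : ℕ := ⌊binaryValue v * 2 ^ n⌋₊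

theorem binaryPrefix_lt (n v : ℕ) : binaryPrefix n v < 2 ^ (n + 1) := by
  have h : binaryValue v < 2 := by
    rw [binaryValue, div_lt_iff₀ (by positivity), ← pow_succ']
    exact_mod_cast Nat.lt_pow_succ_log_self one_lt_two v
  have h0 : 0 ≤ binaryValue v := by unfold binaryValue; positivity
  rw [binaryPrefix, Nat.floor_lt (by positivity), pow_succ']
  push_cast
  gcongr

theorem binaryValue_lt_of_binaryPrefix_lt {n v w : ℕ} (h : binaryPrefix n v < binaryPrefix n w) :
    binaryValue v < binaryValue w := by
  contrapose! h
  exact Nat.floor_le_floor (by gcongr)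

/-- Scaling by `2 ^ n` and taking the floor deletes the last `x - n` digits; `n ≤ x` ensures that
the string has `n` digits after the leading one. -/
theorem binaryPrefix_vertexCode {f : ℕ → ℕ} (hf : ∀ n, f n ≤ 1) {n x : ℕ} (h : n ≤ x) :
    binaryPrefix n (vertexCode f x) = prefixCode f x n := by
  obtain ⟨d, rfl⟩ := Nat.exists_eq_add_of_le h
  rw [binaryPrefix, binaryValue, log_vertexCode hf, vertexCode]
  rw [show ((prefixCode f (n + d) (n + d) : ℚ) / 2 ^ (n + d) * 2 ^ n) =
    (prefixCode f (n + d) (n + d) : ℚ) / (2 ^ d : ℕ) by push_cast; field_simp; ring]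
  rw [Nat.floor_div_eq_div, prefixCode_div hf]

/-! ### The inversion graph and its code -/

/-- The graph of the sequence coded by `f`: two vertices are adjacent if the larger one has the
smaller binary value. -/
def inversionGraph (f : ℕ → ℕ) : NatGraph where
  verts := {v | vertexCode f (Nat.log 2 v) = v}
  Adj v w := vertexCode f (Nat.log 2 v) = v ∧ vertexCode f (Nat.log 2 w) = w ∧
    (v < w ∧ binaryValue w < binaryValue v ∨ w < v ∧ binaryValue v < binaryValue w)
  adj_sub := by
    rintro v w ⟨-, -, h | h⟩
    · exact h.1.ne
    · exact h.1.ne'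
  edge_vert h := h.1
  symm := ⟨fun _ _ h => ⟨h.2.1, h.1, h.2.2.symm⟩⟩

theorem infinite_verts_inversionGraph {f : ℕ → ℕ} (hf : ∀ n, f n ≤ 1) :
    (inversionGraph f).verts.Infinite := by
  refine Set.infinite_of_injective_forall_mem (f := vertexCode f) (fun x y h => ?_) fun x => ?_
  · rw [← log_vertexCode hf x, h, log_vertexCode hf]
  · change vertexCode f (Nat.log 2 (vertexCode f x)) = _
    rw [log_vertexCode hf]

theorem codeSet_apply (X : Set ℕ) (n : ℕ) [Decidable (n ∈ X)] :
    codeSet X n = if n ∈ X then 1 else 0 := by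
  by_cases h : n ∈ X <;> simp [codeSet, h]

theorem codeSet_le_one (X : Set ℕ) (n : ℕ) : codeSet X n ≤ 1 := by
  classical
  rw [codeSet_apply]
  split_ifs <;> simp

theorem codeSet_eq_one_iff {X : Set ℕ} {n : ℕ} : codeSet X n = 1 ↔ n ∈ X := by
  classical
  rw [codeSet_apply]
  split_ifs with h <;> simp [h]

/-- A solution refers to some graph with the given code; injectivity identifies it with the
inversion graph. -/
theorem codeGraph_injective : Function.Injective codeGraph := by
  intro G K h
  have heven : ∀ n, n ∈ G.verts ↔ n ∈ K.verts := fun n => by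
    have := congrFun h (2 * n)
    simp only [codeGraph, joinFun, Nat.mul_mod_right, if_true, Nat.mul_div_cancel_left n two_pos]
      at this
    rw [← codeSet_eq_one_iff, this, codeSet_eq_one_iff]
  have hodd : ∀ v w, v < w → (G.Adj v w ↔ K.Adj v w) := fun v w hvw => by
    have := congrFun h (2 * Nat.pair v w + 1)
    have h1 : (2 * Nat.pair v w + 1) % 2 ≠ 0 := by omega
    have h2 : (2 * Nat.pair v w + 1) / 2 = Nat.pair v w := by omega
    simp only [codeGraph, joinFun, if_neg h1, h2] at this
    have h3 := codeSet_eq_one_iff.symm.trans ((iff_of_eq (congrArg (· = 1) this)).trans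
      codeSet_eq_one_iff)
    simpa [hvw] using h3
  refine SimpleGraph.Subgraph.ext (Set.ext heven) ?_
  funext v w
  rw [eq_iff_iff]
  rcases lt_trichotomy v w with hvw | rfl | hvw
  · exact hodd v w hvw
  · exact iff_of_false (fun h => h.ne rfl) fun h => h.ne rfl
  · rw [G.adj_comm, K.adj_comm]
    exact hodd w v hvw

/-! ### From a solution to a cohesive set -/

/-- The two neighbours `a` and `b` rule out the "at most one" alternative at `c`, and only finitely
many of its infinitely many neighbours precede it. -/
theorem exists_lt_binaryValue_lt {f : ℕ → ℕ} {H : Set ℕ}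
    (hH : IsWeakRivalSands (inversionGraph f) H) {a b c : ℕ} (ha : a ∈ H) (hb : b ∈ H) (hc : c ∈ H)
    (hac : a < c) (hbc : b < c) (hab : a ≠ b) (h1 : binaryValue c < binaryValue a)
    (h2 : binaryValue c < binaryValue b) :
    ∃ d ∈ H, c < d ∧ binaryValue d < binaryValue c := by
  have hadj : ∀ v ∈ H, v < c → binaryValue c < binaryValue v →
      v ∈ H ∩ (inversionGraph f).neighborSet c := fun v hv hvc hlt =>
    ⟨hv, hH.1 hc, hH.1 hv, Or.inr ⟨hvc, hlt⟩⟩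
  rcases hH.2.2 c hc with h | h
  · obtain ⟨d, ⟨hd, -, -, hcd⟩, hlt⟩ := h.exists_gt c
    rcases hcd with hcd | hcd
    · exact ⟨d, hd, hcd⟩
    · exact absurd hcd.1 hlt.not_gt
  · exact (hab (Set.encard_le_one_iff.1 h a b (hadj a ha hac h1) (hadj b hb hbc h2))).elim

/-- The binary lengths of the descent records of a solution to the graph of `A` form a cohesive
set. -/
theorem isCohesive_image_log {A : ℕ → Set ℕ} {H : Set ℕ}
    (hH : IsWeakRivalSands (inversionGraph (codeSeq A)) H) :
    IsCohesive A (Nat.log 2 '' descentRecords binaryValue H) := by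
  have hf : ∀ n, codeSeq A n ≤ 1 := codeSet_le_one _
  have hvert : ∀ v ∈ descentRecords binaryValue H,
      vertexCode (codeSeq A) (Nat.log 2 v) = v := fun v hv => hH.1 hv.1
  refine ⟨?_, fun i => ?_⟩
  · refine (infinite_descentRecords hH.2.1 ?_).image ?_
    · intro a ha b hb c hc hab hbc h1 h2
      exact exists_lt_binaryValue_lt hH ha hb hc (hab.trans hbc) hbc hab.ne (h2.trans h1) h2
    · intro v hv w hw h
      rw [← hvert v hv, h, hvert w hw]
  -- Use `i + 1` digits, so that the last digit of the prefix, the parity of `u`, decides membership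
  -- in `A i`.
  · obtain ⟨u, hu⟩ := exists_finite_ne_of_descentRecords (r := binaryValue) (H := H)
      (q := binaryPrefix (i + 1)) (n := 0) (M := 2 ^ (i + 1 + 1))
      (fun a ha b hb c hc => exists_lt_binaryValue_lt hH ha hb hc)
      (fun a _ => binaryPrefix_lt _ a)
      (fun a _ b _ _ _ h => binaryValue_lt_of_binaryPrefix_lt h)
    have hmem : ∀ v ∈ descentRecords binaryValue H, i < Nat.log 2 v → binaryPrefix (i + 1) v = u →
        (Nat.log 2 v ∈ A i ↔ u % 2 = 1) := by
      intro v hv hi hvu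
      rw [← hvert v hv, binaryPrefix_vertexCode hf hi] at hvu
      have h1 : prefixCode (codeSeq A) (Nat.log 2 v) (i + 1) =
        2 * prefixCode (codeSeq A) (Nat.log 2 v) i + codeSeq A (Nat.pair i (Nat.log 2 v)) := rfl
      have h2 : codeSeq A (Nat.pair i (Nat.log 2 v)) = 1 ↔ Nat.log 2 v ∈ A i := by
        rw [codeSeq, codeSet_eq_one_iff]; simp
      have h3 := hf (Nat.pair i (Nat.log 2 v))
      rw [← h2, ← hvu, h1]
      generalize codeSeq A (Nat.pair i (Nat.log 2 v)) = e at h3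
      omega
    -- The exceptions: records with another prefix, and numbers `x ≤ i`, whose strings do not reach
    -- digit `i`.
    have hfin := (hu.image (Nat.log 2)).union (Set.finite_Iic i)
    by_cases hpar : u % 2 = 1
    · refine Or.inl (hfin.subset ?_)
      rintro _ ⟨⟨v, hv, rfl⟩, hA⟩
      by_contra hn
      simp only [Set.mem_union, Set.mem_Iic, not_or, not_le] at hn
      refine hA ((hmem v hv hn.2 ?_).2 hpar)
      by_contra hvu
      exact hn.1 ⟨v, ⟨hv, hvu⟩, rfl⟩
    · refine Or.inr (hfin.subset ?_)
      rintro _ ⟨⟨v, hv, rfl⟩, hA⟩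
      by_contra hn
      simp only [Set.mem_union, Set.mem_Iic, not_or, not_le] at hn
      refine hA fun hAi => hpar ((hmem v hv hn.2 ?_).1 hAi)
      by_contra hvu
      exact hn.1 ⟨v, ⟨hv, hvu⟩, rfl⟩

/-! ### Computability of the two functionals -/

namespace PrimrecRel

variable {β : Type*} [Primcodable β] {R : ℕ → β → Prop}

theorem bex_lt (hR : PrimrecRel R) : PrimrecRel fun n y => ∃ x < n, R x y :=
  (hR.exists_mem_list.comp (Primrec.list_range.comp Primrec.fst) Primrec.snd).of_eq (by simp)

theorem ball_lt (hR : PrimrecRel R) : PrimrecRel fun n y => ∀ x < n, R x y :=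
  (hR.forall_mem_list.comp (Primrec.list_range.comp Primrec.fst) Primrec.snd).of_eq (by simp)

end PrimrecRel

theorem primrec_vertexCode : Primrec₂ fun (l : List ℕ) x => vertexCode (fun m => l.getD m 0) x := by
  have h : Primrec fun p : List ℕ × ℕ => (Nat.rec 1
      (fun i s => 2 * s + p.1.getD (Nat.pair i p.2) 0) p.2 : ℕ) := by
    refine Primrec.nat_rec' (h := fun (p : List ℕ × ℕ) (q : ℕ × ℕ) =>
      2 * q.2 + p.1.getD (Nat.pair q.1 p.2) 0) Primrec.snd (Primrec.const 1) ?_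
    exact Primrec.nat_add.comp
      (Primrec.nat_mul.comp (Primrec.const 2) (Primrec.snd.comp Primrec.snd))
      ((Primrec.list_getD 0).comp (Primrec.fst.comp Primrec.fst)
        (Primrec₂.natPair.comp (Primrec.fst.comp Primrec.snd) (Primrec.snd.comp Primrec.fst)))
  exact h

theorem primrecRel_vertexCode_eq :
    PrimrecRel fun (l : List ℕ) v => vertexCode (fun m => l.getD m 0) (Nat.log 2 v) = v :=
  Primrec.eq.comp (primrec_vertexCode.comp Primrec.fst (Primrec.nat_log_two.comp Primrec.snd))
    Primrec.snd

theorem primrecRel_binaryValue_lt : PrimrecRel fun v w : ℕ => binaryValue v < binaryValue w := by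
  refine PrimrecPred.of_eq (p := fun q : ℕ × ℕ =>
    q.1 * 2 ^ Nat.log 2 q.2 < q.2 * 2 ^ Nat.log 2 q.1) ?_ fun q => binaryValue_lt_iff.symm
  exact Primrec.nat_lt.comp
    (Primrec.nat_mul.comp Primrec.fst
      (Primrec.nat_pow.comp (Primrec.const 2) (Primrec.nat_log_two.comp Primrec.snd)))
    (Primrec.nat_mul.comp Primrec.snd
      (Primrec.nat_pow.comp (Primrec.const 2) (Primrec.nat_log_two.comp Primrec.fst)))

theorem getD_map_range {f : ℕ → ℕ} {n m : ℕ} (h : m < n) :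
    ((List.range n).map f).getD m 0 = f m := by
  simp [List.getD, h]

open Classical in
/-- The graph of a sequence is uniformly computable from the sequence. -/
theorem exists_eval_eq_codeGraph_inversionGraph :
    ∃ c : OracleCode, ∀ f n, c.eval f n = Part.some (codeGraph (inversionGraph f) n) := by
  have hV : PrimrecPred fun p : ℕ × List ℕ =>
      vertexCode (fun m => p.2.getD m 0) (Nat.log 2 (p.1 / 2)) = p.1 / 2 :=
    primrecRel_vertexCode_eq.comp Primrec.snd (Primrec.nat_div.comp Primrec.fst (Primrec.const 2))
  have hv : Primrec fun p : ℕ × List ℕ => (p.1 / 2).unpair.1 :=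
    Primrec.fst.comp (Primrec.unpair.comp (Primrec.nat_div.comp Primrec.fst (Primrec.const 2)))
  have hw : Primrec fun p : ℕ × List ℕ => (p.1 / 2).unpair.2 :=
    Primrec.snd.comp (Primrec.unpair.comp (Primrec.nat_div.comp Primrec.fst (Primrec.const 2)))
  have hE : PrimrecPred fun p : ℕ × List ℕ =>
      (p.1 / 2).unpair.1 < (p.1 / 2).unpair.2 ∧
      vertexCode (fun m => p.2.getD m 0) (Nat.log 2 (p.1 / 2).unpair.1) = (p.1 / 2).unpair.1 ∧
      vertexCode (fun m => p.2.getD m 0) (Nat.log 2 (p.1 / 2).unpair.2) = (p.1 / 2).unpair.2 ∧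
      binaryValue (p.1 / 2).unpair.2 < binaryValue (p.1 / 2).unpair.1 :=
    (Primrec.nat_lt.comp hv hw).and <| (primrecRel_vertexCode_eq.comp Primrec.snd hv).and <|
      (primrecRel_vertexCode_eq.comp Primrec.snd hw).and (primrecRel_binaryValue_lt.comp hw hv)
  have hF : Primrec fun p : ℕ × List ℕ => if p.1 % 2 = 0 then
      (if vertexCode (fun m => p.2.getD m 0) (Nat.log 2 (p.1 / 2)) = p.1 / 2 then 1 else 0)
    else if (p.1 / 2).unpair.1 < (p.1 / 2).unpair.2 ∧
      vertexCode (fun m => p.2.getD m 0) (Nat.log 2 (p.1 / 2).unpair.1) = (p.1 / 2).unpair.1 ∧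
      vertexCode (fun m => p.2.getD m 0) (Nat.log 2 (p.1 / 2).unpair.2) = (p.1 / 2).unpair.2 ∧
      binaryValue (p.1 / 2).unpair.2 < binaryValue (p.1 / 2).unpair.1 then 1 else 0 :=
    Primrec.ite (Primrec.eq.comp (Primrec.nat_mod.comp Primrec.fst (Primrec.const 2))
        (Primrec.const 0))
      (Primrec.ite hV (Primrec.const 1) (Primrec.const 0))
      (Primrec.ite hE (Primrec.const 1) (Primrec.const 0))
  obtain ⟨c, hc⟩ := OracleCode.exists_eval_eq_of_primrec hF
    (u := fun n => (n + 1) ^ 2)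
    (Primrec.nat_pow.comp Primrec.succ (Primrec.const 2))
  refine ⟨c, fun f n => (hc f n).trans (congrArg Part.some ?_)⟩
  -- Only entries `⟨i, x⟩` with `i < x ≤ n` are read, and these codes are below `(n + 1) ^ 2`, so
  -- the default of `getD` never occurs.
  have hvert : ∀ v ≤ n, vertexCode (fun m => ((List.range ((n + 1) ^ 2)).map f).getD m 0)
      (Nat.log 2 v) = vertexCode f (Nat.log 2 v) := fun v hv =>
    prefixCode_congr fun i hi => getD_map_range <| by
      refine (Nat.pair_lt_max_add_one_sq _ _).trans_le (Nat.pow_le_pow_left ?_ 2)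
      have := Nat.log_le_self 2 v
      omega
  dsimp only
  have h1 := Nat.unpair_left_le (n / 2)
  have h2 := Nat.unpair_right_le (n / 2)
  rw [hvert _ (by omega), hvert _ (by omega), hvert _ (by omega), codeGraph, joinFun,
    codeSet_apply, codeSet_apply]
  refine if_congr Iff.rfl (if_congr Iff.rfl rfl rfl) (if_congr ?_ rfl rfl)
  refine and_congr_right fun hlt => and_congr_right fun _ => and_congr_right fun _ => ?_
  simp [hlt, hlt.not_gt]

open Classical in
/-- The binary lengths of the descent records of a set are uniformly computable from the set. -/
theorem exists_eval_eq_codeSet_image_log :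
    ∃ c : OracleCode, ∀ (H : Set ℕ) n, c.eval (codeSet H) n =
      Part.some (codeSet (Nat.log 2 '' descentRecords binaryValue H) n) := by
  have hM : PrimrecRel fun (l : List ℕ) v => l.getD v 0 = 1 :=
    Primrec.eq.comp (Primrec.list_getD 0) (Primrec.const 1)
  have hA : PrimrecRel fun (a : ℕ) (p : List ℕ × ℕ × ℕ × ℕ) =>
      p.1.getD a 0 = 1 → p.1.getD p.2.1 0 = 1 → p.1.getD p.2.2.1 0 = 1 →
      binaryValue p.2.1 < binaryValue a → binaryValue p.2.2.1 < binaryValue p.2.1 →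
      binaryValue p.2.2.2 < binaryValue p.2.2.1 := by
    have himp : ∀ {α : Type} [Primcodable α] {p q : α → Prop}, PrimrecPred p → PrimrecPred q →
        PrimrecPred fun x => p x → q x := fun hp hq =>
      (hp.not.or hq).of_eq fun x => imp_iff_not_or.symm
    have hl : Primrec fun x : ℕ × List ℕ × ℕ × ℕ × ℕ => x.2.1 := Primrec.fst.comp Primrec.snd
    have hb : Primrec fun x : ℕ × List ℕ × ℕ × ℕ × ℕ => x.2.2.1 :=
      Primrec.fst.comp (Primrec.snd.comp Primrec.snd)
    have hc : Primrec fun x : ℕ × List ℕ × ℕ × ℕ × ℕ => x.2.2.2.1 :=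
      Primrec.fst.comp (Primrec.snd.comp (Primrec.snd.comp Primrec.snd))
    have hh : Primrec fun x : ℕ × List ℕ × ℕ × ℕ × ℕ => x.2.2.2.2 :=
      Primrec.snd.comp (Primrec.snd.comp (Primrec.snd.comp Primrec.snd))
    exact himp (hM.comp hl Primrec.fst) <| himp (hM.comp hl hb) <| himp (hM.comp hl hc) <|
      himp (primrecRel_binaryValue_lt.comp hb Primrec.fst) <|
      himp (primrecRel_binaryValue_lt.comp hc hb) (primrecRel_binaryValue_lt.comp hh hc)
  have hB : PrimrecRel fun (b : ℕ) (p : List ℕ × ℕ × ℕ) => ∀ a < b,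
      p.1.getD a 0 = 1 → p.1.getD b 0 = 1 → p.1.getD p.2.1 0 = 1 →
      binaryValue b < binaryValue a → binaryValue p.2.1 < binaryValue b →
      binaryValue p.2.2 < binaryValue p.2.1 :=
    PrimrecPred.primrecRel <| hA.ball_lt.comp (α := ℕ × List ℕ × ℕ × ℕ) Primrec.fst
      (Primrec.pair (Primrec.fst.comp Primrec.snd)
        (Primrec.pair Primrec.fst (Primrec.snd.comp Primrec.snd)))
  have hC : PrimrecRel fun (c : ℕ) (p : List ℕ × ℕ) => ∀ b < c, ∀ a < b,
      p.1.getD a 0 = 1 → p.1.getD b 0 = 1 → p.1.getD c 0 = 1 →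
      binaryValue b < binaryValue a → binaryValue c < binaryValue b →
      binaryValue p.2 < binaryValue c :=
    PrimrecPred.primrecRel <| hB.ball_lt.comp (α := ℕ × List ℕ × ℕ) Primrec.fst
      (Primrec.pair (Primrec.fst.comp Primrec.snd)
        (Primrec.pair Primrec.fst (Primrec.snd.comp Primrec.snd)))
  have hD : PrimrecRel fun (h : ℕ) (p : ℕ × List ℕ) => (p.2.getD h 0 = 1 ∧
      ∀ c < h, ∀ b < c, ∀ a < b,
      p.2.getD a 0 = 1 → p.2.getD b 0 = 1 → p.2.getD c 0 = 1 →
      binaryValue b < binaryValue a → binaryValue c < binaryValue b →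
      binaryValue h < binaryValue c) ∧ Nat.log 2 h = p.1 :=
    ((hM.comp (Primrec.snd.comp Primrec.snd) Primrec.fst).and
      (hC.ball_lt.comp Primrec.fst (Primrec.pair (Primrec.snd.comp Primrec.snd)
        Primrec.fst))).and
      (Primrec.eq.comp (Primrec.nat_log_two.comp Primrec.fst) (Primrec.fst.comp Primrec.snd))
  -- Any `h` with `Nat.log 2 h = x` is below this bound, and testing whether `h` is a record
  -- consults `H` only up to `h`.
  have hu : Primrec fun x : ℕ => 2 ^ (x + 1) :=
    Primrec.nat_pow.comp (Primrec.const 2) Primrec.succ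
  obtain ⟨c, hc⟩ := OracleCode.exists_eval_eq_of_primrec
    (Primrec.ite (hD.bex_lt.comp (hu.comp Primrec.fst) Primrec.id) (Primrec.const 1)
      (Primrec.const 0)) hu
  refine ⟨c, fun H n => (hc _ n).trans (congrArg Part.some ?_)⟩
  refine (if_congr ?_ rfl rfl).trans (codeSet_apply _ _).symm
  have hmem : ∀ m < 2 ^ (n + 1),
      ((List.range (2 ^ (n + 1))).map (codeSet H)).getD m 0 = 1 ↔ m ∈ H := fun m hm => by
    rw [getD_map_range hm, codeSet_eq_one_iff]
  have hrec : ∀ h < 2 ^ (n + 1), _ ↔ h ∈ descentRecords binaryValue H := fun h hh =>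
    and_congr (hmem h hh) <| forall₂_congr fun c hc => forall₂_congr fun b hb =>
      forall₂_congr fun a ha => imp_congr (hmem a (by omega)) <| imp_congr (hmem b (by omega)) <|
        imp_congr (hmem c (by omega)) Iff.rfl
  constructor
  · rintro ⟨h, hh, h1, h2⟩
    exact ⟨h, (hrec h hh).1 h1, h2⟩
  · rintro ⟨h, h1, rfl⟩
    have hh := Nat.lt_pow_succ_log_self one_lt_two h
    exact ⟨h, hh, (hrec h hh).2 h1, rfl⟩

theorem mainTheorem8 : StronglyWeihrauchReducible COH wRSg := by
  obtain ⟨c, hc⟩ := exists_eval_eq_codeGraph_inversionGraph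
  obtain ⟨d, hd⟩ := exists_eval_eq_codeSet_image_log
  refine ⟨c.functional, d.functional, ⟨c, rfl⟩, ⟨d, rfl⟩, ?_⟩
  rintro _ ⟨A, rfl⟩
  refine ⟨_, OracleCode.mem_functional_of_eval_eq (hc (codeSeq A)),
    ⟨_, infinite_verts_inversionGraph (codeSet_le_one _), rfl⟩, ?_⟩
  rintro _ ⟨G, H, hG, rfl, hH⟩
  obtain rfl := codeGraph_injective hG
  exact ⟨_, OracleCode.mem_functional_of_eval_eq (hd H), A, _, rfl, rfl, isCohesive_image_log hH⟩
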